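/- **Setting.** Let $V$ be a finite-dimensional real normed space with norm $\|\cdot\|$ and dual norm $\|\cdot\|_*$, and let $X\subseteq V$ be closed and convex. Let $\psi:X\to\mathbb R$ be differentiable and 1-strongly convex with respect to $\|\cdot\|$, let $B_\psi(x,y)=\psi(x)-\psi(y)-\langle\nabla\psi(y),x-y\rangle$, and suppose that $D_x:=\sup_{x,y\in X}B_\psi(x,y)<\infty$. For $i\in[m]$ and $r\in[n]$ let $F^i_r:X\to\mathbb R$ be convex and $G$-Lipschitz with respect to $\|\cdot\|$, where $G>0$. Let $\mathcal P^i\subseteq\Delta_n$ (the probability simplex in $\mathbb R^n$) be convex and compact, $\mathcal P=\mathcal P^1\times\dots\times\mathcal P^m$. For $x\in X$, $p\in\mathcal P$ put $\phi(x,p)=\max_{i\in[m]}\sum_r p^{i,(r)}F^i_r(x)$. For weights $\theta_1,\dots,\theta_T$ put $$\epsilon^{\bullet}(\{x_t,p_t,\theta_t\}_{t=1}^T)=\sum_{t=1}^T\theta_t\phi(x_t,p_t)-\inf_{x\in X}\sum_{t=1}^T\theta_t\phi(x,p_t).$$ **Algorithm ($\epsilon$-SMD).** Fix $T\ge 2$,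 a (deterministic) sequence $p_1,\dots,p_T\in\mathcal P$, step sizes $\alpha_t$ and sample sizes $K_t\ge1$. Start from $x_1\in X$. In iteration $t=1,\dots,T$: (1) for each $i$ draw indices $s_{t,1}^i,\dots,s_{t,K_t}^i\in[n]$ from $p_t^i$, all independent of each other and of the past; put $\hat f_t^i(x)=\frac1{K_t}\sum_{k}F^i_{s^i_{t,k}}(x)$ and choose $\hat i_t\in\arg\max_i\hat f_t^i(x_t)$, ties being broken arbitrarily without looking into the future; (2) draw $I_t\in[n]$ whose conditional law, given the past, the samples of iteration $t$ and $\hat i_t$, is $p_t^{\hat i_t}$; (3) choose a subgradient $g_t\in\partial F^{\hat i_t}_{I_t}(x_t)$ with $\|g_t\|_*\le G$, and let $x_{t+1}\in\arg\min_{x\in X}\{\langle g_t,x-x_t\rangle+\frac1{\alpha_t}B_\psi(x,x_t)\}$. **Theorem.** Let $\epsilon>0$, $C_K\in[0,\frac12)$ and $\Omega\ge1$. Let $\{x_t\}$ be generated by $\epsilon$-SMD with $\alpha_t=c_x/\sqrt t$, $c_x=\frac1G\sqrt{D_x/\Omega}$, and let $\theta_t=\alpha_t/\sum_{\tau=1}^T\alpha_\tau$.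 Let $\mathcal E$ be the event that, with $f_t^i(x)=\sum_r p_t^{i,(r)}F_r^i(x)$, $$|\hat f_t^i(x)-f_t^i(x)|\le\tfrac{C_K\epsilon}{2}\qquad\text{for all }x\in X,\ i\in[m],\ t\in[T].$$ If $\mathbb P(\mathcal E)>0$, then $$\mathbb P\Big\{\epsilon^{\bullet}(\{x_t,p_t,\theta_t\}_{t=1}^T)\le\frac{3\sqrt\Omega\,G\ln(T)\sqrt{2D_x}}{\sqrt T}+C_K\epsilon\ \Big|\ \mathcal E\Big\}\ge1-2e^{-\Omega}.$$ If $\nu_1\in(0,1)$ and $\mathbb P(\mathcal E)\ge1-\nu_1$, then $$\mathbb P\Big\{\epsilon^{\bullet}(\{x_t,p_t,\theta_t\}_{t=1}^T)\le\frac{3\sqrt\Omega\,G\ln(T)\sqrt{2D_x}}{\sqrt T}+C_K\epsilon\Big\}\ge1-2e^{-\Omega}-\nu_1.$$ -/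

import Mathlib

open MeasureTheory

noncomputable section

/-- The Bregman distance `B_ψ(x, y) = ψ(x) - ψ(y) - ∇ψ(y)ᵀ(x - y)` of a function `ψ` that is
differentiable on the convex set `X`. For `x, y ∈ X` the value does not depend on which derivative
within `X` is used. -/
def bregman {E : Type*} [NormedAddCommGroup E] [NormedSpace ℝ E]
    (X : Set E) (ψ : E → ℝ) (x y : E) : ℝ :=
  ψ x - ψ y - fderivWithin ℝ ψ X y (x - y)

/-- The set of all values `B_ψ(x, y)` with `x, y ∈ X`. -/
def bregmanValues {E : Type*} [NormedAddCommGroup E] [NormedSpace ℝ E]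
    (X : Set E) (ψ : E → ℝ) : Set ℝ :=
  {b | ∃ x ∈ X, ∃ y ∈ X, b = bregman X ψ x y}

/-- The `ψ`-diameter `D_x = sup_{x, y ∈ X} B_ψ(x, y)`. -/
def bregmanDiam {E : Type*} [NormedAddCommGroup E] [NormedSpace ℝ E]
    (X : Set E) (ψ : E → ℝ) : ℝ :=
  sSup (bregmanValues X ψ)

/-- `∂f(y)`: the subdifferential at `y` of a function `f` on `X`; subgradients are elements of the
dual space. -/
def subdiff {E : Type*} [NormedAddCommGroup E] [NormedSpace ℝ E]
    (X : Set E) (f : E → ℝ) (y : E) : Set (StrongDual ℝ E) :=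
  {g | ∀ x ∈ X, f y + g (x - y) ≤ f x}

/-- `f^i(x) = (p^i)ᵀ F^i(x)`, where `q = p^i` and `Fi r = F^i_r`. -/
def expVal {E : Type*} {n : ℕ} (Fi : Fin n → E → ℝ) (q : Fin n → ℝ) (x : E) : ℝ :=
  ∑ r, q r * Fi r x

/-- `φ(x, p) = max_{i ∈ [m]} (p^i)ᵀ F^i(x)`. -/
def phi {E : Type*} {m n : ℕ} (F : Fin m → Fin n → E → ℝ) (x : E) (p : Fin m → Fin n → ℝ) : ℝ :=
  ⨆ i, expVal (F i) (p i) x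

/-- The sampled value `f̂^i(x) = (1/K) ∑_k F^i_{s_k}(x)` for sampled indices `s_1, …, s_K`. -/
def sampleVal {E : Type*} {n K : ℕ} (Fi : Fin n → E → ℝ) (s : Fin K → Fin n) (x : E) : ℝ :=
  (1 / (K : ℝ)) * ∑ k, Fi (s k) x

/-- `ε^•({x_t, p_t, θ_t}_{t=1}^T)
  = ∑_{t=1}^T θ_t φ(x_t, p_t) - inf_{x ∈ X} ∑_{t=1}^T θ_t φ(x, p_t)`. -/
def epsBullet {E : Type*} {m n : ℕ} (X : Set E) (F : Fin m → Fin n → E → ℝ) (T : ℕ)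
    (x : ℕ → E) (p : ℕ → Fin m → Fin n → ℝ) (θ : ℕ → ℝ) : ℝ :=
  ∑ t ∈ Finset.Icc 1 T, θ t * phi F (x t) (p t)
    - ⨅ y : X, ∑ t ∈ Finset.Icc 1 T, θ t * phi F (y : E) (p t)

/-- The weights obtained by normalizing `α_1, …, α_T`. -/
def normalized (T : ℕ) (α : ℕ → ℝ) (t : ℕ) : ℝ :=
  α t / ∑ τ ∈ Finset.Icc 1 T, α τ

/-- The step size `α_t = c_x / √t` with `c_x = (1/G) √(D_x / Ω)`. -/
def stepSize (G D Om : ℝ) (t : ℕ) : ℝ :=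
  (1 / G * Real.sqrt (D / Om)) / Real.sqrt (t : ℝ)

/-- The event that `|f̂_t^i(x) - f_t^i(x)| ≤ C_K ε / 2` for all `x ∈ X`, `i ∈ [m]`, `t ∈ [T]`, where
`s t ω i` are the indices sampled from `p_t^i` in iteration `t`. -/
def approxEvent {E Ω : Type*} {m n : ℕ} (X : Set E) (F : Fin m → Fin n → E → ℝ) (T : ℕ)
    (p : ℕ → Fin m → Fin n → ℝ) (K : ℕ → ℕ) (s : (t : ℕ) → Ω → Fin m → Fin (K t) → Fin n)
    (CK ε : ℝ) : Set Ω :=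
  {ω | ∀ t ∈ Finset.Icc 1 T, ∀ i, ∀ y ∈ X,
    |sampleVal (F i) (s t ω i) y - expVal (F i) (p t i) y| ≤ CK * ε / 2}

/-- `T` iterations of ε-stochastic mirror descent for a given sequence `p_1, …, p_T`, as random
variables on a probability space: iterates `x t`, samples `s t` (the index `s t ω i k` is the
`k`-th index sampled from `p_t^i`), approximately maximizing indices `ihat t`, and indices `I t`
from which the stochastic subgradient is formed. The σ-algebra `ℱ t` is the information available
when iteration `t` begins. -/
structure IsEpsSMD {E : Type*} [NormedAddCommGroup E] [NormedSpace ℝ E] [MeasurableSpace E]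
    {Ω : Type*} {mΩ : MeasurableSpace Ω} (P : Measure Ω) (ℱ : Filtration ℕ mΩ)
    {m n : ℕ} (X : Set E) (ψ : E → ℝ) (F : Fin m → Fin n → E → ℝ) (G : ℝ) (T : ℕ)
    (p : ℕ → Fin m → Fin n → ℝ) (α : ℕ → ℝ) (K : ℕ → ℕ)
    (x : ℕ → Ω → E) (s : (t : ℕ) → Ω → Fin m → Fin (K t) → Fin n)
    (ihat : ℕ → Ω → Fin m) (I : ℕ → Ω → Fin n) : Prop where
  /-- The initial point lies in `X`. -/
  init_mem : ∀ ω, x 1 ω ∈ X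
  init_meas : Measurable[ℱ 1] (x 1)
  /-- Everything drawn or computed in iteration `t` is known after it. -/
  next_meas : ∀ t ∈ Finset.Icc 1 T, Measurable[ℱ (t + 1)] (x (t + 1))
  sample_meas : ∀ t ∈ Finset.Icc 1 T, Measurable[ℱ (t + 1)] (s t)
  ihat_meas : ∀ t ∈ Finset.Icc 1 T, Measurable[ℱ (t + 1)] (ihat t)
  index_meas : ∀ t ∈ Finset.Icc 1 T, Measurable[ℱ (t + 1)] (I t)
  /-- Given the past, the indices `s t · i k` are independent and `s t · i k` has law `p_t^i`. -/
  sample_law : ∀ t ∈ Finset.Icc 1 T, ∀ A, MeasurableSet[ℱ t] A →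
    ∀ σ : Fin m → Fin (K t) → Fin n,
      P (A ∩ {ω | s t ω = σ}) = P A * ENNReal.ofReal (∏ i, ∏ k, p t i (σ i k))
  /-- `ihat t` maximizes the sampled value `f̂_t^i(x_t)` over `i`; ties are broken arbitrarily. -/
  ihat_argmax : ∀ t ∈ Finset.Icc 1 T, ∀ ω i,
    sampleVal (F i) (s t ω i) (x t ω) ≤ sampleVal (F (ihat t ω)) (s t ω (ihat t ω)) (x t ω)
  /-- Given the past, the samples `s t` and `ihat t = j`, the index `I t` has law `p_t^j`. -/
  index_law : ∀ t ∈ Finset.Icc 1 T, ∀ A, MeasurableSet[ℱ t] A →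
    ∀ (σ : Fin m → Fin (K t) → Fin n) (j : Fin m) (r : Fin n),
      P (A ∩ {ω | s t ω = σ} ∩ {ω | ihat t ω = j} ∩ {ω | I t ω = r})
        = P (A ∩ {ω | s t ω = σ} ∩ {ω | ihat t ω = j}) * ENNReal.ofReal (p t j r)
  /-- For some subgradient `g` of `F^i_r` at `x_t`, with `i = ihat t` and `r = I t`, of dual norm at
  most the Lipschitz constant `G`, the next iterate minimizes
  `gᵀ(x - x_t) + (1/α_t) B_ψ(x, x_t)` over `X`. (A subgradient of a `G`-Lipschitz convex function at
  an interior point of its domain always satisfies the norm bound; at a boundary point of `X` a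
  subgradient relative to `X` could be arbitrarily long.) -/
  step : ∀ t ∈ Finset.Icc 1 T, ∀ ω,
    ∃ g ∈ subdiff X (F (ihat t ω) (I t ω)) (x t ω), ‖g‖ ≤ G ∧ x (t + 1) ω ∈ X ∧
      IsMinOn (fun y => g (y - x t ω) + 1 / α t * bregman X ψ y (x t ω)) X (x (t + 1) ω)

end

/-! Let `y` minimize `∑ θ_t φ(·, p_t)` over `X`. The `p_t` are deterministic, hence so is `y`, and
no supremum over comparators has to be controlled. On the approximation event `ihat t` maximizes
`f_t^i(x_t)` up to `CK * ε`, so `φ(x_t, p_t) - φ(y, p_t)` is at most the gap of `f_t^i` between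
`x_t` and `y` for `i = ihat t`, plus `CK * ε` (`phi_sub_phi_le`). That gap is the conditional mean
of the gap of the sampled function `F^i_r`, `r = I t`.

The sampled gaps, weighted by `α_t`, obey the pathwise mirror descent bound `D + ∑ α_t² G² / 2`
(`mirror_step_le`, `regret_le`). The weighted differences between mean and sampled gaps are
martingale increments; Hoeffding's lemma and a Chernoff bound with parameter `Ω / D` keep their sum
below `D (1 + ∑ 1 / t)` outside probability `e^{-Ω}` (`cond_deviation_le`). Since `‖g_t‖ ≤ G` holds
surely, no second exponential is lost.

The martingale property must survive conditioning on the approximation event. This event is an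
intersection of requirements on the samples of single iterations: earlier ones belong to the past,
the current one restricts to sample values for each of which `I t` has the right law, and later ones
are independent (`cond_index_law`).

Finally one divides by `∑ α_t ≥ c_x √T`. -/

/-! ### Bregman distances and the mirror descent step -/

open Filter Topology in
/-- The slopes of `ψ` along a segment of `X` converge to the derivative within `X`. -/
theorem tendsto_segment_slope {E : Type*} [NormedAddCommGroup E] [NormedSpace ℝ E]
    {X : Set E} (hX : Convex ℝ X) {ψ : E → ℝ} (hψ : DifferentiableOn ℝ ψ X)
    {x y : E} (hx : x ∈ X) (hy : y ∈ X) :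
    Tendsto (fun s : ℝ => s⁻¹ * (ψ (x + s • (y - x)) - ψ x)) (𝓝[>] 0)
      (𝓝 (fderivWithin ℝ ψ X x (y - x))) := by
  have hγ : HasDerivWithinAt (fun s : ℝ => x + s • (y - x)) (y - x) (Set.Ioo 0 1) 0 := by
    simpa using (((hasDerivAt_id (0 : ℝ)).smul_const (y - x)).const_add x).hasDerivWithinAt
      (s := Set.Ioo 0 1)
  have hmaps : Set.MapsTo (fun s : ℝ => x + s • (y - x)) (Set.Ioo 0 1) X := fun s hs =>
    hX.add_smul_sub_mem hx hy ⟨hs.1.le, hs.2.le⟩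
  have hf : HasFDerivWithinAt ψ (fderivWithin ℝ ψ X x) X (x + (0 : ℝ) • (y - x)) := by
    simpa using (hψ x hx).hasFDerivWithinAt
  have h := hf.comp_hasDerivWithinAt (0 : ℝ) hγ hmaps
  rw [hasDerivWithinAt_iff_tendsto_slope' (by simp),
    nhdsWithin_Ioo_eq_nhdsGT (zero_lt_one' ℝ)] at h
  refine h.congr fun s => ?_
  simp [slope_def_field, div_eq_inv_mul]

-- Divide the strong convexity inequality on the segment from `y` to `x` by its parameter `s` and
-- let `s → 0`.
open Filter Topology in
theorem half_sq_norm_sub_le_bregman {E : Type*} [NormedAddCommGroup E] [NormedSpace ℝ E]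
    {X : Set E} (hX : Convex ℝ X) {ψ : E → ℝ} (hψ : DifferentiableOn ℝ ψ X)
    (hs : StrongConvexOn X 1 ψ) {x y : E} (hx : x ∈ X) (hy : y ∈ X) :
    ‖x - y‖ ^ 2 / 2 ≤ bregman X ψ x y := by
  have h1 := tendsto_segment_slope hX hψ hy hx
  have h2 : Tendsto (fun s : ℝ => ψ x - ψ y - (1 - s) * (‖x - y‖ ^ 2 / 2)) (𝓝[>] 0)
      (𝓝 (ψ x - ψ y - (1 - 0) * (‖x - y‖ ^ 2 / 2))) :=
    (Continuous.tendsto (by fun_prop) 0).mono_left nhdsWithin_le_nhds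
  have h3 := le_of_tendsto_of_tendsto h1 h2 ?_
  · unfold bregman
    linarith
  · filter_upwards [Ioo_mem_nhdsGT (zero_lt_one' ℝ)] with s hs01
    have h4 := hs.2 hx hy hs01.1.le (sub_nonneg.2 hs01.2.le) (by ring)
    have h5 : s • x + (1 - s) • y = y + s • (x - y) := by module
    rw [h5] at h4
    simp only [smul_eq_mul] at h4
    rw [inv_mul_le_iff₀ hs01.1]
    linarith

open Filter Topology in
/-- One step of mirror descent: the three-point inequality. -/
theorem mirror_step_le {E : Type*} [NormedAddCommGroup E] [NormedSpace ℝ E]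
    {X : Set E} (hX : Convex ℝ X) {ψ : E → ℝ} (hψ : DifferentiableOn ℝ ψ X)
    (hs : StrongConvexOn X 1 ψ) {x x' y : E} (hx : x ∈ X) (hx' : x' ∈ X) (hy : y ∈ X)
    {g : StrongDual ℝ E} {G α : ℝ} (hg : ‖g‖ ≤ G) (hα : 0 < α)
    (hmin : IsMinOn (fun z => g (z - x) + 1 / α * bregman X ψ z x) X x') :
    α * g (x - y) ≤ bregman X ψ y x - bregman X ψ y x' + α ^ 2 * G ^ 2 / 2 := by
  have h1 := tendsto_segment_slope hX hψ hx' hy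
  -- First-order optimality of `x'`: compare it with points of the segment towards `y`, divide by
  -- `s`, let `s → 0`.
  have h2 : -(α * g (y - x')) + fderivWithin ℝ ψ X x (y - x')
      ≤ fderivWithin ℝ ψ X x' (y - x') := by
    refine ge_of_tendsto h1 ?_
    filter_upwards [Ioo_mem_nhdsGT (zero_lt_one' ℝ)] with s hs01
    have h3 := hmin (hX.add_smul_sub_mem hx' hy ⟨hs01.1.le, hs01.2.le⟩)
    have h5 : x' + s • (y - x') - x = (x' - x) + s • (y - x') := by module
    simp only [Set.mem_ofPred_eq, bregman, h5, map_add, map_smul, smul_eq_mul] at h3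
    have h6 := mul_le_mul_of_nonneg_left h3 hα.le
    simp only [mul_add, ← mul_assoc, mul_one_div_cancel hα.ne', one_mul] at h6
    rw [le_inv_mul_iff₀ hs01.1]
    linarith
  have h4 := half_sq_norm_sub_le_bregman hX hψ hs hx' hx
  have h5 : g (x - x') ≤ G * ‖x' - x‖ := by
    calc g (x - x') ≤ ‖g (x - x')‖ := le_abs_self _
      _ ≤ ‖g‖ * ‖x - x'‖ := g.le_opNorm _
      _ ≤ G * ‖x' - x‖ := by rw [norm_sub_rev]; gcongr
  have h6 := mul_le_mul_of_nonneg_left h5 hα.le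
  -- Young's inequality for `α G ‖x' - x‖`; its quadratic term is absorbed by the strong convexity
  -- bound `h4`.
  have h7 := sq_nonneg (α * G - ‖x' - x‖)
  simp only [bregman, map_sub] at h2 h4 h6 ⊢
  linarith

theorem sum_Icc_le_of_telescope {a b c : ℕ → ℝ} {T : ℕ}
    (h : ∀ t ∈ Finset.Icc 1 T, a t ≤ b t - b (t + 1) + c t) :
    ∑ t ∈ Finset.Icc 1 T, a t ≤ b 1 - b (T + 1) + ∑ t ∈ Finset.Icc 1 T, c t := by
  refine (Finset.sum_le_sum h).trans_eq ?_
  rw [Finset.sum_add_distrib]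
  congr 1
  clear h
  induction T with
  | zero => simp
  | succ k ih => rw [Finset.sum_Icc_succ_top (by omega), ih]; ring

/-! ### Exponential moments and tail bounds -/

/-- Hoeffding's lemma for a distribution on a finite set. -/
theorem sum_mul_exp_le_of_mem_Icc {n : ℕ} {q : Fin n → ℝ} (hq : q ∈ stdSimplex ℝ (Fin n))
    {z : Fin n → ℝ} {R : ℝ} (hR : 0 ≤ R) (hz : ∀ r, |z r| ≤ R) (l : ℝ) :
    ∑ r, q r * Real.exp (l * (∑ r', q r' * z r' - z r)) ≤ Real.exp (l ^ 2 * R ^ 2 / 2) := by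
  have hsum : ∑ r, ENNReal.ofReal (q r) = 1 := by
    rw [← ENNReal.ofReal_sum_of_nonneg fun r _ => hq.1 r, hq.2, ENNReal.ofReal_one]
  let μ : Measure (Fin n) := (PMF.ofFintype (fun r => ENNReal.ofReal (q r)) hsum).toMeasure
  have hint : ∀ f : Fin n → ℝ, ∫ r, f r ∂μ = ∑ r, q r * f r := fun f => by
    rw [PMF.integral_eq_sum]
    exact Finset.sum_congr rfl fun r _ => by
      simp [PMF.ofFintype_apply, ENNReal.toReal_ofReal (hq.1 r)]
  -- The parameter is `-l` because the exponent contains mean minus value.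
  have h := (ProbabilityTheory.hasSubgaussianMGF_of_mem_Icc (μ := μ) (X := z) (a := -R) (b := R)
    (Measurable.of_discrete).aemeasurable
    (Filter.Eventually.of_forall fun r => abs_le.1 (hz r))).mgf_le (-l)
  rw [ProbabilityTheory.mgf, hint, hint] at h
  refine (Finset.sum_congr rfl fun r _ => ?_).trans_le (h.trans_eq ?_)
  · congr 2; ring
  · have : ‖R - -R‖ = 2 * R := by rw [Real.norm_of_nonneg (by linarith)]; ring
    congr 1
    simp only [NNReal.coe_pow, NNReal.coe_div, coe_nnnorm, this, NNReal.coe_ofNat]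
    ring

/-- Exponential moment bound for a sum of increments `d t (J t) (I t)`, where `I t` has law
`p t j` given the past and `J t = j`. -/
theorem lintegral_exp_sum_le {Ω : Type*} {mΩ : MeasurableSpace Ω} {Q : Measure Ω}
    [IsProbabilityMeasure Q] {ℱ : Filtration ℕ mΩ} {m n T : ℕ}
    {J : ℕ → Ω → Fin m} {I : ℕ → Ω → Fin n} {p : ℕ → Fin m → Fin n → ℝ}
    (hJ : ∀ t ∈ Finset.Icc 1 T, Measurable[ℱ (t + 1)] (J t))
    (hI : ∀ t ∈ Finset.Icc 1 T, Measurable[ℱ (t + 1)] (I t))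
    (hp : ∀ t ∈ Finset.Icc 1 T, ∀ j r, 0 ≤ p t j r)
    (hlaw : ∀ t ∈ Finset.Icc 1 T, ∀ A, MeasurableSet[ℱ t] A → ∀ j r,
      Q (A ∩ {ω | J t ω = j} ∩ {ω | I t ω = r})
        = Q (A ∩ {ω | J t ω = j}) * ENNReal.ofReal (p t j r))
    {d : ℕ → Fin m → Fin n → Ω → ℝ}
    (hd : ∀ t ∈ Finset.Icc 1 T, ∀ j r, Measurable[ℱ t] (d t j r))
    {v : ℕ → ℝ}
    (hv : ∀ t ∈ Finset.Icc 1 T, ∀ ω j, ∑ r, p t j r * Real.exp (d t j r ω) ≤ Real.exp (v t))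
    {k : ℕ} (hk : k ≤ T) :
    Measurable[ℱ (k + 1)] (fun ω => ∑ t ∈ Finset.Icc 1 k, d t (J t ω) (I t ω) ω) ∧
    ∫⁻ ω, ENNReal.ofReal (Real.exp (∑ t ∈ Finset.Icc 1 k, d t (J t ω) (I t ω) ω)) ∂Q
      ≤ ENNReal.ofReal (Real.exp (∑ t ∈ Finset.Icc 1 k, v t)) := by
  induction k with
  | zero => simp
  | succ k ih =>
    obtain ⟨ihm, ihb⟩ := ih (by omega)
    have ht : k + 1 ∈ Finset.Icc 1 T := Finset.mem_Icc.2 ⟨by omega, hk⟩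
    set M : Ω → ℝ := fun ω => ∑ t ∈ Finset.Icc 1 k, d t (J t ω) (I t ω) ω with hM
    have hsucc : ∀ ω, ∑ t ∈ Finset.Icc 1 (k + 1), d t (J t ω) (I t ω) ω
        = M ω + d (k + 1) (J (k + 1) ω) (I (k + 1) ω) ω := fun ω => by
      rw [Finset.sum_Icc_succ_top (by omega)]
    have hle : ℱ (k + 1) ≤ ℱ (k + 1 + 1) := ℱ.mono (Nat.le_succ _)
    have hJm := hJ _ ht
    have hIm := hI _ ht
    have hJm' := hJm.mono (ℱ.le _) le_rfl
    have hIm' := hIm.mono (ℱ.le _) le_rfl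
    refine ⟨?_, ?_⟩
    · simp_rw [hsucc]
      refine (ihm.mono hle le_rfl).add ?_
      have h1 : Measurable[(ℱ (k + 1 + 1)).prod inferInstance]
          (fun q : Ω × (Fin m × Fin n) => d (k + 1) q.2.1 q.2.2 q.1) :=
        @measurable_from_prod_countable_left _ _ _ (ℱ (k + 1 + 1)) _ _ _ _ _
          fun q => (hd _ ht q.1 q.2).mono hle le_rfl
      exact h1.comp (Measurable.prodMk measurable_id (hJm.prodMk hIm))
    set W : Fin m → Fin n → Ω → ENNReal := fun j r ω =>
      ENNReal.ofReal (Real.exp (M ω + d (k + 1) j r ω)) with hW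
    have hWm : ∀ j r, Measurable[ℱ (k + 1)] (W j r) := fun j r =>
      ENNReal.measurable_ofReal.comp (Real.measurable_exp.comp (ihm.add (hd _ ht j r)))
    -- `W j r` is known at time `k + 1`, so only the restriction of `Q` to that σ-algebra matters,
    -- and there `hlaw` turns fixing `I = r` into the factor `p`. The set `J = j` itself need not be
    -- known by then, so it stays as a domain of integration.
    have hrest : ∀ j r, ∫⁻ ω in {ω | J (k + 1) ω = j} ∩ {ω | I (k + 1) ω = r}, W j r ω ∂Q
        = ENNReal.ofReal (p (k + 1) j r) * ∫⁻ ω in {ω | J (k + 1) ω = j}, W j r ω ∂Q := by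
      intro j r
      have htrim : (Q.restrict ({ω | J (k + 1) ω = j} ∩ {ω | I (k + 1) ω = r})).trim (ℱ.le (k + 1))
          = ENNReal.ofReal (p (k + 1) j r) •
            (Q.restrict {ω | J (k + 1) ω = j}).trim (ℱ.le (k + 1)) := by
        refine @Measure.ext _ (ℱ (k + 1)) _ _ fun A hA => ?_
        rw [Measure.smul_apply, trim_measurableSet_eq _ hA, trim_measurableSet_eq _ hA,
          Measure.restrict_apply (ℱ.le _ _ hA), Measure.restrict_apply (ℱ.le _ _ hA),
          ← Set.inter_assoc, hlaw _ ht A hA, mul_comm, smul_eq_mul]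
      rw [← lintegral_trim (ℱ.le (k + 1)) (hWm j r), htrim, lintegral_smul_measure,
        lintegral_trim (ℱ.le (k + 1)) (hWm j r), smul_eq_mul]
    have hJs : ∀ j, MeasurableSet {ω | J (k + 1) ω = j} := fun j =>
      hJm' (measurableSet_singleton j)
    have hIs : ∀ r, MeasurableSet {ω | I (k + 1) ω = r} := fun r =>
      hIm' (measurableSet_singleton r)
    have hsplit : ∀ f : Ω → ENNReal, ∫⁻ ω, f ω ∂Q
        = ∑ j, ∫⁻ ω in {ω | J (k + 1) ω = j}, f ω ∂Q := fun f => by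
      rw [← tsum_fintype (L := .unconditional _), ← lintegral_iUnion hJs, ← setLIntegral_univ]
      · congr; ext ω; simp
      · exact fun a b hab => Set.disjoint_left.2 fun ω h1 h2 => hab (h1.symm.trans h2)
    have hsplit2 : ∀ (f : Ω → ENNReal) j, ∫⁻ ω in {ω | J (k + 1) ω = j}, f ω ∂Q
        = ∑ r, ∫⁻ ω in {ω | J (k + 1) ω = j} ∩ {ω | I (k + 1) ω = r}, f ω ∂Q := fun f j => by
      rw [← tsum_fintype (L := .unconditional _),
        ← lintegral_iUnion fun r => (hJs j).inter (hIs r)]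
      · rw [← Set.inter_iUnion, Set.iUnion_eq_univ_iff.2 fun ω => ⟨I (k + 1) ω, rfl⟩,
          Set.inter_univ]
      · exact fun a b hab => Set.disjoint_left.2 fun ω h1 h2 => hab (h1.2.symm.trans h2.2)
    simp_rw [hsucc]
    calc ∫⁻ ω, ENNReal.ofReal (Real.exp (M ω + d (k + 1) (J (k + 1) ω) (I (k + 1) ω) ω)) ∂Q
        = ∑ j, ∑ r, ∫⁻ ω in {ω | J (k + 1) ω = j} ∩ {ω | I (k + 1) ω = r}, W j r ω ∂Q := by
          rw [hsplit]
          refine Finset.sum_congr rfl fun j _ => ?_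
          rw [hsplit2]
          refine Finset.sum_congr rfl fun r _ => ?_
          refine setLIntegral_congr_fun ((hJs j).inter (hIs r)) fun ω hω => ?_
          obtain ⟨h1, h2⟩ := hω
          simp only [Set.mem_ofPred_eq] at h1 h2
          simp only [h1, h2, hW]
      _ = ∑ j, ∫⁻ ω in {ω | J (k + 1) ω = j},
            ∑ r, ENNReal.ofReal (p (k + 1) j r) * W j r ω ∂Q := by
          refine Finset.sum_congr rfl fun j _ => ?_
          rw [lintegral_finsetSum]
          · refine Finset.sum_congr rfl fun r _ => ?_
            rw [hrest, lintegral_const_mul _ ((hWm j r).mono (ℱ.le _) le_rfl)]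
          · exact fun r _ => ((hWm j r).mono (ℱ.le _) le_rfl).const_mul _
      _ ≤ ∑ j, ∫⁻ ω in {ω | J (k + 1) ω = j},
            ENNReal.ofReal (Real.exp (v (k + 1))) * ENNReal.ofReal (Real.exp (M ω)) ∂Q := by
          refine Finset.sum_le_sum fun j _ => lintegral_mono fun ω => ?_
          have h1 : ∀ r, ENNReal.ofReal (p (k + 1) j r) * W j r ω
              = ENNReal.ofReal (p (k + 1) j r * Real.exp (d (k + 1) j r ω))
                * ENNReal.ofReal (Real.exp (M ω)) := fun r => by
            rw [hW, ← ENNReal.ofReal_mul (hp _ ht j r), ← ENNReal.ofReal_mul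
              (mul_nonneg (hp _ ht j r) (Real.exp_nonneg _)), Real.exp_add]
            congr 1; ring
          simp only [h1, ← Finset.sum_mul]
          gcongr
          rw [← ENNReal.ofReal_sum_of_nonneg fun r _ =>
            mul_nonneg (hp _ ht j r) (Real.exp_nonneg _)]
          exact ENNReal.ofReal_le_ofReal (hv _ ht ω j)
      _ = ENNReal.ofReal (Real.exp (v (k + 1))) * ∫⁻ ω, ENNReal.ofReal (Real.exp (M ω)) ∂Q := by
          rw [← hsplit, lintegral_const_mul]
          exact ENNReal.measurable_ofReal.comp
            (Real.measurable_exp.comp (ihm.mono (ℱ.le _) le_rfl))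
      _ ≤ ENNReal.ofReal (Real.exp (v (k + 1)))
            * ENNReal.ofReal (Real.exp (∑ t ∈ Finset.Icc 1 k, v t)) := by gcongr
      _ = _ := by
          rw [← ENNReal.ofReal_mul (Real.exp_nonneg _), ← Real.exp_add,
            Finset.sum_Icc_succ_top (by omega), add_comm]

/-- Chernoff bound from an exponential moment. -/
theorem le_measureReal_of_lintegral_exp_le {Ω : Type*} {mΩ : MeasurableSpace Ω} {Q : Measure Ω}
    [IsProbabilityMeasure Q] {M : Ω → ℝ} (hM : Measurable M) {a b : ℝ}
    (h : ∫⁻ ω, ENNReal.ofReal (Real.exp (M ω)) ∂Q ≤ ENNReal.ofReal (Real.exp a)) :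
    1 - Real.exp (-b) ≤ Q.real {ω | M ω ≤ a + b} := by
  have h1 : Q {ω | M ω ≤ a + b}ᶜ ≤ ENNReal.ofReal (Real.exp (-b)) := by
    -- Markov's inequality at level `e^{a + b}`.
    have h2 := mul_meas_ge_le_lintegral
      (ENNReal.measurable_ofReal.comp (Real.measurable_exp.comp hM)) (μ := Q)
      (ENNReal.ofReal (Real.exp (a + b)))
    have h3 : Q {ω | M ω ≤ a + b}ᶜ
        ≤ Q {ω | ENNReal.ofReal (Real.exp (a + b)) ≤ ENNReal.ofReal (Real.exp (M ω))} := by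
      refine measure_mono fun ω hω => ?_
      simp only [Set.mem_compl_iff, Set.mem_ofPred_eq, not_le] at hω ⊢
      exact ENNReal.ofReal_le_ofReal (Real.exp_le_exp.2 hω.le)
    have h4 : ENNReal.ofReal (Real.exp (a + b)) * Q {ω | M ω ≤ a + b}ᶜ
        ≤ ENNReal.ofReal (Real.exp (a + b)) * ENNReal.ofReal (Real.exp (-b)) := by
      rw [← ENNReal.ofReal_mul (Real.exp_nonneg _), ← Real.exp_add, add_neg_cancel_right]
      exact (mul_le_mul_right h3 _).trans (h2.trans h)
    rwa [ENNReal.mul_le_mul_iff_right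
      (by simpa using Real.exp_pos _) ENNReal.ofReal_ne_top] at h4
  have h5 := probReal_compl_eq_one_sub (μ := Q)
    (measurableSet_le hM measurable_const : MeasurableSet {ω | M ω ≤ a + b})
  have h6 : Q.real {ω | M ω ≤ a + b}ᶜ ≤ Real.exp (-b) :=
    ENNReal.toReal_le_of_le_ofReal (Real.exp_nonneg _) h1
  linarith

/-! ### The approximation event and the filtration -/

/-- An event determined by later samples is independent of the past. -/
theorem exists_measure_inter_future_eq {Ω : Type*} {mΩ : MeasurableSpace Ω} {P : Measure Ω}
    {ℱ : Filtration ℕ mΩ} {T : ℕ} {V : ℕ → Set Ω}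
    (hVm : ∀ t ∈ Finset.Icc 1 T, MeasurableSet[ℱ (t + 1)] (V t))
    (hV : ∀ t ∈ Finset.Icc 1 T, ∃ c, ∀ A, MeasurableSet[ℱ t] A → P (A ∩ V t) = P A * c)
    {t k : ℕ} (htk : t ≤ k) (hk : k ≤ T) :
    ∃ c, ∀ B, MeasurableSet[ℱ (t + 1)] B →
      MeasurableSet[ℱ (k + 1)] (B ∩ ⋂ τ ∈ Finset.Ioc t k, V τ) ∧
      P (B ∩ ⋂ τ ∈ Finset.Ioc t k, V τ) = P B * c := by
  induction k, htk using Nat.le_induction with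
  | base => exact ⟨1, fun B hB => by simpa using hB⟩
  | succ k htk ih =>
    have hkT : k + 1 ∈ Finset.Icc 1 T := Finset.mem_Icc.2 ⟨by omega, hk⟩
    obtain ⟨c, hc⟩ := ih (by omega)
    obtain ⟨c', hc'⟩ := hV _ hkT
    refine ⟨c * c', fun B hB => ?_⟩
    have h1 : B ∩ ⋂ τ ∈ Finset.Ioc t (k + 1), V τ
        = (B ∩ ⋂ τ ∈ Finset.Ioc t k, V τ) ∩ V (k + 1) := by
      rw [← Finset.insert_Ioc_right_eq_Ioc_add_one (by omega), Finset.set_biInter_insert,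
        Set.inter_comm (V (k + 1)), Set.inter_assoc]
    rw [h1]
    refine ⟨MeasurableSet.inter (ℱ.mono (Nat.le_succ _) _ (hc B hB).1) (hVm _ hkT), ?_⟩
    rw [hc' _ (hc B hB).1, (hc B hB).2, mul_assoc]

/-- The set of samples of iteration `t` that satisfy the approximation requirement. -/
def goodSamples {E : Type*} {m n : ℕ} (X : Set E) (F : Fin m → Fin n → E → ℝ)
    (p : ℕ → Fin m → Fin n → ℝ) (K : ℕ → ℕ) (CK ε : ℝ) (t : ℕ) :
    Set (Fin m → Fin (K t) → Fin n) :=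
  {σ | ∀ i, ∀ y ∈ X, |sampleVal (F i) (σ i) y - expVal (F i) (p t i) y| ≤ CK * ε / 2}

theorem approxEvent_eq_iInter {E Ω : Type*} {m n : ℕ} (X : Set E) (F : Fin m → Fin n → E → ℝ)
    (T : ℕ) (p : ℕ → Fin m → Fin n → ℝ) (K : ℕ → ℕ)
    (s : (t : ℕ) → Ω → Fin m → Fin (K t) → Fin n) (CK ε : ℝ) :
    approxEvent X F T p K s CK ε = ⋂ t ∈ Finset.Icc 1 T, s t ⁻¹' goodSamples X F p K CK ε t := by
  ext ω
  simp only [Set.mem_iInter]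
  rfl

open Classical in
/-- A measure can be summed over the values of a finite-valued random variable. -/
theorem measure_inter_preimage_eq_sum {Ω ι : Type*} {mΩ : MeasurableSpace Ω} [Fintype ι]
    [MeasurableSpace ι] [MeasurableSingletonClass ι] (P : Measure Ω) {s : Ω → ι}
    (hs : Measurable s) (S : Set ι) (A : Set Ω) :
    P (A ∩ s ⁻¹' S) = ∑ σ with σ ∈ S, P (A ∩ {ω | s ω = σ}) := by
  have h := sum_measure_preimage_singleton (μ := P.restrict A) (f := s)
    (Finset.univ.filter (· ∈ S)) fun σ _ => hs (measurableSet_singleton σ)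
  rw [Measure.restrict_apply (hs (Finset.measurableSet _))] at h
  simp only [Finset.coe_filter, Finset.mem_univ, true_and, Set.ofPred_mem_eq] at h
  rw [Set.inter_comm, ← h]
  refine Finset.sum_congr rfl fun σ _ => ?_
  rw [Measure.restrict_apply (hs (measurableSet_singleton σ)), Set.inter_comm]
  rfl

/-! ### Properties of a run of the algorithm -/

namespace IsEpsSMD

variable {E : Type*} [NormedAddCommGroup E] [NormedSpace ℝ E] [MeasurableSpace E]
    {Ω : Type*} {mΩ : MeasurableSpace Ω} {P : Measure Ω} {ℱ : Filtration ℕ mΩ}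
    {m n : ℕ} {X : Set E} {ψ : E → ℝ} {F : Fin m → Fin n → E → ℝ} {G : ℝ} {T : ℕ}
    {p : ℕ → Fin m → Fin n → ℝ} {α : ℕ → ℝ} {K : ℕ → ℕ}
    {x : ℕ → Ω → E} {s : (t : ℕ) → Ω → Fin m → Fin (K t) → Fin n}
    {ihat : ℕ → Ω → Fin m} {I : ℕ → Ω → Fin n}

theorem iterate_mem (h : IsEpsSMD P ℱ X ψ F G T p α K x s ihat I) {t : ℕ}
    (ht : t ∈ Finset.Icc 1 T) (ω : Ω) : x t ω ∈ X := by
  obtain ⟨h1, h2⟩ := Finset.mem_Icc.1 ht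
  obtain rfl | h3 := h1.eq_or_lt
  · exact h.init_mem ω
  · obtain ⟨k, rfl⟩ := Nat.exists_eq_add_one_of_ne_zero (by omega : t ≠ 0)
    obtain ⟨g, -, -, hx, -⟩ := h.step k (Finset.mem_Icc.2 ⟨by omega, by omega⟩) ω
    exact hx

theorem iterate_measurable (h : IsEpsSMD P ℱ X ψ F G T p α K x s ihat I) {t : ℕ}
    (ht : t ∈ Finset.Icc 1 T) : Measurable[ℱ t] (x t) := by
  obtain ⟨h1, h2⟩ := Finset.mem_Icc.1 ht
  obtain rfl | h3 := h1.eq_or_lt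
  · exact h.init_meas
  · obtain ⟨k, rfl⟩ := Nat.exists_eq_add_one_of_ne_zero (by omega : t ≠ 0)
    exact h.next_meas k (Finset.mem_Icc.2 ⟨by omega, by omega⟩)

theorem measurable_continuousOn_comp [BorelSpace E]
    (h : IsEpsSMD P ℱ X ψ F G T p α K x s ihat I) {t : ℕ} (ht : t ∈ Finset.Icc 1 T)
    {f : E → ℝ} (hf : ContinuousOn f X) : Measurable[ℱ t] (fun ω => f (x t ω)) := by
  have h1 : Measurable[ℱ t] (fun ω => (⟨x t ω, h.iterate_mem ht ω⟩ : X)) :=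
    (h.iterate_measurable ht).subtype_mk
  exact (continuousOn_iff_continuous_domRestrict.1 hf).measurable.comp h1

theorem measurableSet_good (h : IsEpsSMD P ℱ X ψ F G T p α K x s ihat I) {CK ε : ℝ} {t : ℕ}
    (ht : t ∈ Finset.Icc 1 T) :
    MeasurableSet[ℱ (t + 1)] (s t ⁻¹' goodSamples X F p K CK ε t) :=
  h.sample_meas t ht (Set.toFinite _).measurableSet

theorem measurableSet_approxEvent (h : IsEpsSMD P ℱ X ψ F G T p α K x s ihat I) {CK ε : ℝ} :
    MeasurableSet (approxEvent X F T p K s CK ε) := by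
  rw [approxEvent_eq_iInter]
  exact Finset.measurableSet_biInter _ fun t ht => ℱ.le _ _ (h.measurableSet_good ht)

/-- Conditioning on the approximation event, which depends on the samples only, does not change
the law of `I t` given the past and `ihat t`. -/
theorem cond_index_law (h : IsEpsSMD P ℱ X ψ F G T p α K x s ihat I) {CK ε : ℝ} {t : ℕ}
    (ht : t ∈ Finset.Icc 1 T) (A : Set Ω) (hA : MeasurableSet[ℱ t] A) (j : Fin m) (r : Fin n) :
    ProbabilityTheory.cond P (approxEvent X F T p K s CK ε)
        (A ∩ {ω | ihat t ω = j} ∩ {ω | I t ω = r})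
      = ProbabilityTheory.cond P (approxEvent X F T p K s CK ε) (A ∩ {ω | ihat t ω = j})
        * ENNReal.ofReal (p t j r) := by
  classical
  obtain ⟨ht1, htT⟩ := Finset.mem_Icc.1 ht
  set V : ℕ → Set Ω := fun τ => s τ ⁻¹' goodSamples X F p K CK ε τ with hVdef
  have hVm : ∀ τ ∈ Finset.Icc 1 T, MeasurableSet[ℱ (τ + 1)] (V τ) := fun τ hτ =>
    h.measurableSet_good hτ
  have hsm : ∀ τ ∈ Finset.Icc 1 T, Measurable (s τ) := fun τ hτ =>
    (h.sample_meas τ hτ).mono (ℱ.le _) le_rfl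
  have hV : ∀ τ ∈ Finset.Icc 1 T, ∃ c, ∀ A, MeasurableSet[ℱ τ] A → P (A ∩ V τ) = P A * c := by
    intro τ hτ
    refine ⟨∑ σ with σ ∈ goodSamples X F p K CK ε τ, ENNReal.ofReal (∏ i, ∏ k, p τ i (σ i k)),
      fun A hA => ?_⟩
    rw [hVdef, measure_inter_preimage_eq_sum P (hsm τ hτ), Finset.mul_sum]
    exact Finset.sum_congr rfl fun σ _ => h.sample_law τ hτ A hA σ
  -- The later iterations contribute one constant factor `c`, the same with and without the
  -- constraint on `I t`.
  obtain ⟨c, hc⟩ := exists_measure_inter_future_eq hVm hV htT le_rfl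
  -- Used only for measurability: the requirements up to `t - 1` lie in `ℱ t` and can be merged into
  -- `A`.
  obtain ⟨_, hpast⟩ := exists_measure_inter_future_eq hVm hV (Nat.zero_le (t - 1)) (by omega)
  have hpm := (hpast Set.univ MeasurableSet.univ).1
  rw [Set.univ_inter, Nat.sub_add_cancel ht1] at hpm
  have hE : approxEvent X F T p K s CK ε
      = ((⋂ τ ∈ Finset.Ioc 0 (t - 1), V τ) ∩ V t) ∩ ⋂ τ ∈ Finset.Ioc t T, V τ := by
    rw [approxEvent_eq_iInter]
    ext ω
    simp only [Set.mem_iInter, Set.mem_inter_iff, Finset.mem_Icc, Finset.mem_Ioc]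
    refine ⟨fun hω => ⟨⟨fun τ hτ => hω τ (by omega), hω t (by omega)⟩,
      fun τ hτ => hω τ (by omega)⟩, fun hω τ hτ => ?_⟩
    rcases lt_trichotomy τ t with h1 | rfl | h1
    · exact hω.1.1 τ (by omega)
    · exact hω.1.2
    · exact hω.2 τ (by omega)
  set A' := A ∩ ⋂ τ ∈ Finset.Ioc 0 (t - 1), V τ with hA'
  have hA'm : MeasurableSet[ℱ t] A' := MeasurableSet.inter hA hpm
  have hJm : MeasurableSet[ℱ (t + 1)] {ω | ihat t ω = j} :=
    h.ihat_meas t ht (measurableSet_singleton j)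
  have hIm : MeasurableSet[ℱ (t + 1)] {ω | I t ω = r} :=
    h.index_meas t ht (measurableSet_singleton r)
  have hA'' : MeasurableSet[ℱ (t + 1)] A' := ℱ.mono (Nat.le_succ t) _ hA'm
  -- The law of `I t` does not depend on the value of the samples, so it factors out of the sum over
  -- admissible values.
  have hmain : P ((A' ∩ {ω | ihat t ω = j} ∩ {ω | I t ω = r}) ∩ V t)
      = P ((A' ∩ {ω | ihat t ω = j}) ∩ V t) * ENNReal.ofReal (p t j r) := by
    rw [hVdef, measure_inter_preimage_eq_sum P (hsm t ht),
      measure_inter_preimage_eq_sum P (hsm t ht), Finset.sum_mul]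
    refine Finset.sum_congr rfl fun σ _ => ?_
    have := h.index_law t ht A' hA'm σ j r
    convert this using 2
    · ext ω; simp only [Set.mem_inter_iff]; tauto
    · congr 1; ext ω; simp only [Set.mem_inter_iff]; tauto
  have e1 : approxEvent X F T p K s CK ε ∩ (A ∩ {ω | ihat t ω = j} ∩ {ω | I t ω = r})
      = ((A' ∩ {ω | ihat t ω = j} ∩ {ω | I t ω = r}) ∩ V t) ∩ ⋂ τ ∈ Finset.Ioc t T, V τ := by
    rw [hE, hA']; ext ω; simp only [Set.mem_inter_iff]; tauto
  have e2 : approxEvent X F T p K s CK ε ∩ (A ∩ {ω | ihat t ω = j})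
      = ((A' ∩ {ω | ihat t ω = j}) ∩ V t) ∩ ⋂ τ ∈ Finset.Ioc t T, V τ := by
    rw [hE, hA']; ext ω; simp only [Set.mem_inter_iff]; tauto
  rw [ProbabilityTheory.cond_apply h.measurableSet_approxEvent,
    ProbabilityTheory.cond_apply h.measurableSet_approxEvent, e1, e2,
    (hc _ (((hA''.inter hJm).inter hIm).inter (hVm t ht))).2,
    (hc _ ((hA''.inter hJm).inter (hVm t ht))).2, hmain]
  ring

/-- On the approximation event, `ihat t` nearly attains `φ(x_t, p_t)`. -/
theorem phi_sub_phi_le (h : IsEpsSMD P ℱ X ψ F G T p α K x s ihat I) {CK ε : ℝ} {ω : Ω}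
    (hω : ω ∈ approxEvent X F T p K s CK ε) {t : ℕ} (ht : t ∈ Finset.Icc 1 T) (y : E) :
    phi F (x t ω) (p t) - phi F y (p t)
      ≤ expVal (F (ihat t ω)) (p t (ihat t ω)) (x t ω)
        - expVal (F (ihat t ω)) (p t (ihat t ω)) y + CK * ε := by
  have : Nonempty (Fin m) := ⟨ihat t ω⟩
  have h1 : expVal (F (ihat t ω)) (p t (ihat t ω)) y ≤ phi F y (p t) :=
    le_ciSup (f := fun i => expVal (F i) (p t i) y) (Set.finite_range _).bddAbove (ihat t ω)
  have h2 : phi F (x t ω) (p t)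
      ≤ expVal (F (ihat t ω)) (p t (ihat t ω)) (x t ω) + CK * ε := by
    -- The error `CK * ε / 2` enters twice, once for `i` and once for `ihat t`.
    refine ciSup_le fun i => ?_
    have h3 := abs_le.1 (hω t ht i _ (h.iterate_mem ht ω))
    have h4 := abs_le.1 (hω t ht (ihat t ω) _ (h.iterate_mem ht ω))
    have h5 := h.ihat_argmax t ht ω i
    linarith [h3.1, h4.2]
  linarith

/-- The regret bound of mirror descent for the sampled functions. -/
theorem regret_le (h : IsEpsSMD P ℱ X ψ F G T p α K x s ihat I) (hX : Convex ℝ X)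
    (hψ : DifferentiableOn ℝ ψ X) (hs : StrongConvexOn X 1 ψ) (hD : BddAbove (bregmanValues X ψ))
    (hα : ∀ t ∈ Finset.Icc 1 T, 0 < α t) {y : E} (hy : y ∈ X) (hT : 1 ≤ T) (ω : Ω) :
    ∑ t ∈ Finset.Icc 1 T, α t * (F (ihat t ω) (I t ω) (x t ω) - F (ihat t ω) (I t ω) y)
      ≤ bregmanDiam X ψ + ∑ t ∈ Finset.Icc 1 T, α t ^ 2 * G ^ 2 / 2 := by
  have h1 := sum_Icc_le_of_telescope (T := T)
    (a := fun t => α t * (F (ihat t ω) (I t ω) (x t ω) - F (ihat t ω) (I t ω) y))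
    (b := fun t => bregman X ψ y (x t ω)) (c := fun t => α t ^ 2 * G ^ 2 / 2) fun t ht => by
      obtain ⟨g, hg, hgG, hx', hmin⟩ := h.step t ht ω
      refine le_trans ?_ (mirror_step_le hX hψ hs (h.iterate_mem ht ω) hx' hy hgG (hα t ht) hmin)
      refine mul_le_mul_of_nonneg_left ?_ (hα t ht).le
      have h2 := hg y hy
      simp only [map_sub] at h2 ⊢
      linarith
  have hxT : x (T + 1) ω ∈ X := by
    obtain ⟨g, -, -, hx', -⟩ := h.step T (Finset.mem_Icc.2 ⟨hT, le_rfl⟩) ω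
    exact hx'
  have h3 := half_sq_norm_sub_le_bregman hX hψ hs hy hxT
  have h4 : bregman X ψ y (x 1 ω) ≤ bregmanDiam X ψ :=
    le_csSup hD ⟨y, hy, _, h.init_mem ω, rfl⟩
  linarith [sq_nonneg ‖y - x (T + 1) ω‖]

end IsEpsSMD

/-! ### Diameter, comparator and step size estimates -/

theorem norm_sub_le_sqrt_bregmanDiam {E : Type*} [NormedAddCommGroup E] [NormedSpace ℝ E]
    {X : Set E} (hX : Convex ℝ X) {ψ : E → ℝ} (hψ : DifferentiableOn ℝ ψ X)
    (hs : StrongConvexOn X 1 ψ) (hD : BddAbove (bregmanValues X ψ)) {x y : E}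
    (hx : x ∈ X) (hy : y ∈ X) : ‖x - y‖ ≤ √(2 * bregmanDiam X ψ) := by
  refine Real.le_sqrt_of_sq_le ?_
  have h1 := half_sq_norm_sub_le_bregman hX hψ hs hx hy
  have h2 : bregman X ψ x y ≤ bregmanDiam X ψ := le_csSup hD ⟨x, hx, y, hy, rfl⟩
  linarith

theorem continuousOn_phi {E : Type*} [TopologicalSpace E] {m n : ℕ} [NeZero m] {X : Set E}
    {F : Fin m → Fin n → E → ℝ} (hF : ∀ i r, ContinuousOn (F i r) X) (p : Fin m → Fin n → ℝ) :
    ContinuousOn (fun x => phi F x p) X := by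
  have h : (fun x => phi F x p)
      = fun x => Finset.univ.sup' Finset.univ_nonempty fun i => expVal (F i) (p i) x := by
    ext x
    rw [Finset.sup'_univ_eq_ciSup]
    rfl
  rw [h]
  refine ContinuousOn.finset_sup'_apply _ fun i _ => ?_
  exact continuousOn_finsetSum _ fun r _ => continuousOn_const.mul (hF i r)

/-- Since `y` attains the infimum, `ε^•` is a weighted mean of the gaps; the weights sum to one, so
`C` passes through unchanged. -/
theorem epsBullet_le {E : Type*} {m n : ℕ} {X : Set E} {F : Fin m → Fin n → E → ℝ} {T : ℕ}
    {x : ℕ → E} {p : ℕ → Fin m → Fin n → ℝ} {α u : ℕ → ℝ} {B C : ℝ} {y : E} (hT : 1 ≤ T)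
    (hα : ∀ t ∈ Finset.Icc 1 T, 0 < α t) (hy : y ∈ X)
    (hmin : IsMinOn (fun z => ∑ t ∈ Finset.Icc 1 T, normalized T α t * phi F z (p t)) X y)
    (hu : ∀ t ∈ Finset.Icc 1 T, phi F (x t) (p t) - phi F y (p t) ≤ u t + C)
    (hB : ∑ t ∈ Finset.Icc 1 T, α t * u t ≤ (∑ t ∈ Finset.Icc 1 T, α t) * B) :
    epsBullet X F T x p (normalized T α) ≤ B + C := by
  have hS : 0 < ∑ t ∈ Finset.Icc 1 T, α t :=
    Finset.sum_pos hα (Finset.nonempty_Icc.2 hT)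
  have : Nonempty X := ⟨⟨y, hy⟩⟩
  have h1 : ∑ t ∈ Finset.Icc 1 T, normalized T α t * phi F y (p t)
      ≤ ⨅ z : X, ∑ t ∈ Finset.Icc 1 T, normalized T α t * phi F (z : E) (p t) :=
    le_ciInf fun z => hmin z.2
  have h2 : ∑ t ∈ Finset.Icc 1 T, normalized T α t * (phi F (x t) (p t) - phi F y (p t))
      ≤ ∑ t ∈ Finset.Icc 1 T, normalized T α t * (u t + C) :=
    Finset.sum_le_sum fun t ht =>
      mul_le_mul_of_nonneg_left (hu t ht) (div_nonneg (hα t ht).le hS.le)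
  have h3 : ∑ t ∈ Finset.Icc 1 T, normalized T α t * (u t + C)
      = (∑ t ∈ Finset.Icc 1 T, α t * u t) / (∑ t ∈ Finset.Icc 1 T, α t) + C := by
    simp only [normalized, mul_add, Finset.sum_add_distrib, ← Finset.sum_mul, ← Finset.sum_div,
      div_mul_eq_mul_div]
    rw [mul_div_right_comm, div_self hS.ne', one_mul]
  have h4 : (∑ t ∈ Finset.Icc 1 T, α t * u t) / (∑ t ∈ Finset.Icc 1 T, α t) ≤ B := by
    rwa [div_le_iff₀' hS]
  simp only [mul_sub, Finset.sum_sub_distrib] at h2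
  unfold epsBullet
  linarith

theorem stepSize_pos {G D Om : ℝ} (hG : 0 < G) (hD : 0 < D) (hOm : 0 < Om) {t : ℕ} (ht : 0 < t) :
    0 < stepSize G D Om t := by
  unfold stepSize
  positivity

theorem stepSize_sq {G D Om : ℝ} (hG : 0 < G) (hD : 0 ≤ D) (hOm : 0 < Om) (t : ℕ) :
    stepSize G D Om t ^ 2 * G ^ 2 = D / Om * (t : ℝ)⁻¹ := by
  unfold stepSize
  rw [div_pow, mul_pow, Real.sq_sqrt (by positivity), Real.sq_sqrt (by positivity)]
  field_simp

/-- The step sizes decrease, so each of the `T` terms is at least the last one. -/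
theorem le_sum_stepSize {G D Om : ℝ} (hG : 0 < G) (T : ℕ) :
    1 / G * √(D / Om) * √T ≤ ∑ t ∈ Finset.Icc 1 T, stepSize G D Om t := by
  have h : ∀ t ∈ Finset.Icc 1 T, 1 / G * √(D / Om) / √T ≤ stepSize G D Om t := fun t ht => by
    obtain ⟨h1, h2⟩ := Finset.mem_Icc.1 ht
    have : 0 < (t : ℝ) := by exact_mod_cast h1
    unfold stepSize
    gcongr
  refine le_trans (le_of_eq ?_) (Finset.sum_le_sum h)
  rw [Finset.sum_const, Nat.card_Icc, Nat.add_sub_cancel, nsmul_eq_mul, mul_div_assoc',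
    mul_comm (T : ℝ), mul_div_assoc, Real.div_sqrt]

theorem sum_inv_le_one_add_log (T : ℕ) :
    ∑ t ∈ Finset.Icc 1 T, (t : ℝ)⁻¹ ≤ 1 + Real.log T := by
  have h := harmonic_le_one_add_log T
  rw [harmonic_eq_sum_Icc] at h
  push_cast at h
  exact h

/-- The left side collects `D` and `D / 2 * ∑ 1 / t` from the regret (using `Ω ≥ 1`) and `D (1 + ∑ 1
/ t)` from the deviation. With `∑ 1 / t ≤ 1 + log T` it remains to see `7 / 2 + 3 / 2 * log T ≤ 3 √2
log T`, which holds from `T = 4` on but fails for `T = 3`. -/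
theorem mul_le_sum_stepSize_mul {G D Om : ℝ} (hG : 0 < G) (hD : 0 < D) (hOm : 0 < Om) {T : ℕ}
    (hT : 4 ≤ T) :
    D * (2 + 3 / 2 * ∑ t ∈ Finset.Icc 1 T, (t : ℝ)⁻¹)
      ≤ (∑ t ∈ Finset.Icc 1 T, stepSize G D Om t)
        * (3 * √Om * G * Real.log T * √(2 * D) / √T) := by
  have hT0 : 0 < (T : ℝ) := by exact_mod_cast (by omega : 0 < T)
  have hlog : 1.38 ≤ Real.log T := by
    have h1 : Real.log 4 ≤ Real.log T := Real.log_le_log (by norm_num) (by exact_mod_cast hT)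
    have h2 : Real.log 4 = 2 * Real.log 2 := by
      rw [show (4 : ℝ) = 2 ^ 2 by norm_num, Real.log_pow]; norm_num
    linarith [Real.log_two_gt_d9]
  have h1 := sum_inv_le_one_add_log T
  have h2 : 1.4 ≤ √2 := Real.le_sqrt_of_sq_le (by norm_num)
  have h3 : D * (2 + 3 / 2 * ∑ t ∈ Finset.Icc 1 T, (t : ℝ)⁻¹) ≤ D * (3 * Real.log T * √2) := by
    gcongr
    nlinarith
  refine h3.trans ?_
  refine le_trans (le_of_eq ?_)
    (mul_le_mul_of_nonneg_right (le_sum_stepSize hG T) (by positivity))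
  rw [Real.sqrt_div hD.le, Real.sqrt_mul zero_le_two]
  have h4 : √Om ≠ 0 := by positivity
  have h5 : √(T : ℝ) ≠ 0 := by positivity
  field_simp
  rw [Real.sq_sqrt hD.le]

theorem sqrt_le_three_mul_log {T : ℕ} (hT : 2 ≤ T) (hT' : T < 4) : √T ≤ 3 * Real.log T := by
  have h0 : (2 : ℝ) ≤ T := by exact_mod_cast hT
  have h3 : (T : ℝ) ≤ 3 := by exact_mod_cast (by omega : T ≤ 3)
  have h1 : Real.log 2 ≤ Real.log T := Real.log_le_log (by norm_num) h0
  have h2 : √(T : ℝ) ≤ 2 := Real.sqrt_le_iff.2 ⟨by norm_num, by linarith⟩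
  linarith [Real.log_two_gt_d9]

theorem abs_sub_le_of_bregmanDiam {E : Type*} [NormedAddCommGroup E] [NormedSpace ℝ E]
    {X : Set E} {ψ : E → ℝ} {G : NNReal} {f : E → ℝ} (hX : Convex ℝ X) (hψ : DifferentiableOn ℝ ψ X)
    (hs : StrongConvexOn X 1 ψ) (hD : BddAbove (bregmanValues X ψ)) (hf : LipschitzOnWith G f X)
    {y z : E} (hy : y ∈ X) (hz : z ∈ X) : |f y - f z| ≤ G * √(2 * bregmanDiam X ψ) := by
  have h1 := hf.dist_le_mul y hy z hz
  rw [Real.dist_eq, dist_eq_norm] at h1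
  exact h1.trans (mul_le_mul_of_nonneg_left
    (norm_sub_le_sqrt_bregmanDiam hX hψ hs hD hy hz) G.coe_nonneg)

theorem expVal_sub_expVal {E : Type*} {n : ℕ} (Fi : Fin n → E → ℝ) (q : Fin n → ℝ) (y z : E) :
    expVal Fi q y - expVal Fi q z = ∑ r, q r * (Fi r y - Fi r z) := by
  simp [expVal, mul_sub]

/-- Strong convexity and finite `D` make `X` bounded, hence compact, so a deterministic comparator
exists. -/
theorem exists_isMinOn_sum_phi {E : Type*} [NormedAddCommGroup E] [NormedSpace ℝ E]
    [FiniteDimensional ℝ E] {m n : ℕ} {X : Set E} {ψ : E → ℝ} {F : Fin m → Fin n → E → ℝ}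
    {p : ℕ → Fin m → Fin n → ℝ} (hX_closed : IsClosed X) (hX : Convex ℝ X) (hne : X.Nonempty)
    (hψ : DifferentiableOn ℝ ψ X) (hs : StrongConvexOn X 1 ψ) (hD : BddAbove (bregmanValues X ψ))
    [NeZero m] (hF : ∀ i r, ContinuousOn (F i r) X) (θ : ℕ → ℝ) (T : ℕ) :
    ∃ y ∈ X, IsMinOn (fun z => ∑ t ∈ Finset.Icc 1 T, θ t * phi F z (p t)) X y := by
  have hb : Bornology.IsBounded X := Metric.isBounded_iff.2
    ⟨√(2 * bregmanDiam X ψ), fun a ha b hb => by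
      rw [dist_eq_norm]; exact norm_sub_le_sqrt_bregmanDiam hX hψ hs hD ha hb⟩
  exact (Metric.isCompact_of_isClosed_isBounded hX_closed hb).exists_isMinOn hne
    (continuousOn_finsetSum _ fun t _ => continuousOn_const.mul (continuousOn_phi hF _))

/-! ### Bounds conditional on the approximation event -/

section run

variable {E : Type*} [NormedAddCommGroup E] [NormedSpace ℝ E]
    [MeasurableSpace E] [BorelSpace E] {m n : ℕ} {X : Set E} {ψ : E → ℝ}
    {F : Fin m → Fin n → E → ℝ} {G : NNReal} {T : ℕ} {p : ℕ → Fin m → Fin n → ℝ}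
    {ε CK Om : ℝ} {K : ℕ → ℕ} {Ω : Type*} {mΩ : MeasurableSpace Ω} {P : Measure Ω}
    {ℱ : Filtration ℕ mΩ} {x : ℕ → Ω → E} {s : (t : ℕ) → Ω → Fin m → Fin (K t) → Fin n}
    {ihat : ℕ → Ω → Fin m} {I : ℕ → Ω → Fin n}

/-- Conditionally on the approximation event, the regret with respect to a fixed point exceeds the
regret of the sampled functions by at most `D (1 + ∑ 1 / t)` with probability `1 - e^{-Ω}`. -/
theorem cond_deviation_le (hX : Convex ℝ X) (hψ : DifferentiableOn ℝ ψ X)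
    (hs : StrongConvexOn X 1 ψ) (hD : BddAbove (bregmanValues X ψ))
    (hDpos : 0 < bregmanDiam X ψ) (hG : 0 < G)
    (hF_lip : ∀ i r, LipschitzOnWith G (F i r) X)
    (hp : ∀ t ∈ Finset.Icc 1 T, ∀ i, p t i ∈ stdSimplex ℝ (Fin n)) (hOm : 1 ≤ Om)
    [IsProbabilityMeasure P]
    (hrun : IsEpsSMD P ℱ X ψ F G T p (stepSize G (bregmanDiam X ψ) Om) K x s ihat I)
    (hE : P (approxEvent X F T p K s CK ε) ≠ 0) {y : E} (hy : y ∈ X) :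
    1 - Real.exp (-Om) ≤ (ProbabilityTheory.cond P (approxEvent X F T p K s CK ε)).real
      {ω | ∑ t ∈ Finset.Icc 1 T, stepSize G (bregmanDiam X ψ) Om t *
          ((expVal (F (ihat t ω)) (p t (ihat t ω)) (x t ω)
            - expVal (F (ihat t ω)) (p t (ihat t ω)) y)
            - (F (ihat t ω) (I t ω) (x t ω) - F (ihat t ω) (I t ω) y))
        ≤ bregmanDiam X ψ * (1 + ∑ t ∈ Finset.Icc 1 T, (t : ℝ)⁻¹)} := by
  set D := bregmanDiam X ψ with hDdef
  have hG' : (0 : ℝ) < G := hG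
  have hOm0 : 0 < Om := by linarith
  have := ProbabilityTheory.cond_isProbabilityMeasure hE
  have hFm : ∀ t ∈ Finset.Icc 1 T, ∀ j r, Measurable[ℱ t] fun ω => F j r (x t ω) :=
    fun t ht j r => hrun.measurable_continuousOn_comp ht (hF_lip j r).continuousOn
  obtain ⟨hm, hint⟩ := lintegral_exp_sum_le
    (Q := ProbabilityTheory.cond P (approxEvent X F T p K s CK ε))
    hrun.ihat_meas hrun.index_meas (fun t ht j r => (hp t ht j).1 r)
    (fun t ht A hA j r => hrun.cond_index_law ht A hA j r)
    -- The factor `Om / D` is the Chernoff parameter: with `R = G √(2 D)` and `α_t² G² = D / (Ω t)`,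
    -- Hoeffding's exponent becomes `Ω / t`.
    (d := fun t j r ω => Om / D * stepSize G D Om t *
      (∑ r', p t j r' * (F j r' (x t ω) - F j r' y) - (F j r (x t ω) - F j r y)))
    (v := fun t => Om * (t : ℝ)⁻¹)
    (fun t ht j r => by
      refine Measurable.const_mul (Measurable.sub (Finset.measurable_sum _ fun r' _ =>
        Measurable.const_mul ((hFm t ht j r').sub_const _) _) ((hFm t ht j r).sub_const _)) _)
    (fun t ht ω j => by
      refine (sum_mul_exp_le_of_mem_Icc (hp t ht j) (R := G * √(2 * D)) (by positivity)
        (fun r => abs_sub_le_of_bregmanDiam hX hψ hs hD (hF_lip j r) (hrun.iterate_mem ht ω) hy)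
        _).trans_eq ?_
      congr 1
      have h1 := stepSize_sq hG' hDpos.le hOm0 t
      rw [mul_pow _ (√(2 * D)), Real.sq_sqrt (by positivity)]
      calc (Om / D * stepSize G D Om t) ^ 2 * (G ^ 2 * (2 * D)) / 2
          = Om ^ 2 / D * (stepSize G D Om t ^ 2 * G ^ 2) := by field_simp
        _ = _ := by rw [h1]; field_simp)
    le_rfl
  refine (le_measureReal_of_lintegral_exp_le (hm.mono (ℱ.le _) le_rfl) (b := Om) hint).trans ?_
  refine measureReal_mono fun ω hω => ?_
  simp only [Set.mem_ofPred_eq] at hω ⊢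
  simp only [expVal_sub_expVal]
  simp only [mul_assoc (Om / D), ← Finset.mul_sum] at hω
  have h2 : Om / D * ∑ t ∈ Finset.Icc 1 T, stepSize G D Om t *
      (∑ r', p t (ihat t ω) r' * (F (ihat t ω) r' (x t ω) - F (ihat t ω) r' y)
        - (F (ihat t ω) (I t ω) (x t ω) - F (ihat t ω) (I t ω) y))
      ≤ Om / D * (D * (1 + ∑ t ∈ Finset.Icc 1 T, (t : ℝ)⁻¹)) := by
    refine hω.trans_eq ?_
    field_simp
    ring
  exact le_of_mul_le_mul_left h2 (by positivity)

/-- The bound conditionally on the approximation event, with failure probability `e^{-Ω}`. -/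
theorem cond_epsBullet_le [FiniteDimensional ℝ E] (hX_closed : IsClosed X) (hX : Convex ℝ X)
    (hψ : DifferentiableOn ℝ ψ X) (hs : StrongConvexOn X 1 ψ) (hD : BddAbove (bregmanValues X ψ))
    (hG : 0 < G) (hF_lip : ∀ i r, LipschitzOnWith G (F i r) X) (hT : 2 ≤ T)
    (hp : ∀ t ∈ Finset.Icc 1 T, ∀ i, p t i ∈ stdSimplex ℝ (Fin n))
    (hCKε : 0 ≤ CK * ε) (hOm : 1 ≤ Om) [IsProbabilityMeasure P]
    (hrun : IsEpsSMD P ℱ X ψ F G T p (stepSize G (bregmanDiam X ψ) Om) K x s ihat I)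
    (hE : P (approxEvent X F T p K s CK ε) ≠ 0) :
    1 - Real.exp (-Om) ≤ (ProbabilityTheory.cond P (approxEvent X F T p K s CK ε)).real
      {ω | epsBullet X F T (fun t => x t ω) p (normalized T (stepSize G (bregmanDiam X ψ) Om))
        ≤ 3 * √Om * G * Real.log T * √(2 * bregmanDiam X ψ) / √T + CK * ε} := by
  set D := bregmanDiam X ψ with hDdef
  have hQ := ProbabilityTheory.cond_isProbabilityMeasure hE
  obtain ⟨ω₀⟩ : Nonempty Ω := nonempty_of_isProbabilityMeasure P
  have hne : X.Nonempty := ⟨_, hrun.init_mem ω₀⟩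
  have hm : NeZero m := ⟨fun h0 => by subst h0; exact (ihat 1 ω₀).elim0⟩
  have hG' : (0 : ℝ) < G := hG
  have hOm0 : 0 < Om := by linarith
  have hlogT : 0 ≤ Real.log T := Real.log_natCast_nonneg T
  have hD0 : 0 ≤ D := by
    obtain ⟨y, hy⟩ := hne
    exact le_trans (by positivity) ((half_sq_norm_sub_le_bregman hX hψ hs hy hy).trans
      (le_csSup hD ⟨y, hy, y, hy, rfl⟩))
  have hexp := Real.exp_pos (-Om)
  obtain hDz | hDpos := hD0.eq_or_lt
  -- If `D = 0`, all step sizes vanish and the weights are `0 / 0 = 0`, so the claim reads `0 ≤ CK *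
  -- ε`.
  · have hall : {ω | epsBullet X F T (fun t => x t ω) p (normalized T (stepSize G D Om))
        ≤ 3 * √Om * G * Real.log T * √(2 * D) / √T + CK * ε} = Set.univ := by
      ext ω
      simp [epsBullet, normalized, stepSize, ← hDz, hCKε]
    rw [hall, probReal_univ]
    linarith
  have hα : ∀ t ∈ Finset.Icc 1 T, 0 < stepSize G D Om t := fun t ht =>
    stepSize_pos hG' hDpos hOm0 (Finset.mem_Icc.1 ht).1
  obtain ⟨y, hy, hmin⟩ := exists_isMinOn_sum_phi (p := p) hX_closed hX hne hψ hs hD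
    (fun i r => (hF_lip i r).continuousOn) (normalized T (stepSize G D Om)) T
  set B := 3 * √Om * G * Real.log T * √(2 * D) / √T with hB
  set u : Ω → ℕ → ℝ := fun ω t => expVal (F (ihat t ω)) (p t (ihat t ω)) (x t ω)
    - expVal (F (ihat t ω)) (p t (ihat t ω)) y with hu
  have key : ∀ ω ∈ approxEvent X F T p K s CK ε,
      ∑ t ∈ Finset.Icc 1 T, stepSize G D Om t * u ω t
        ≤ (∑ t ∈ Finset.Icc 1 T, stepSize G D Om t) * B →
      epsBullet X F T (fun t => x t ω) p (normalized T (stepSize G D Om)) ≤ B + CK * ε :=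
    fun ω hω h => epsBullet_le (by omega) hα hy hmin (fun t ht => hrun.phi_sub_phi_le hω ht y) h
  -- `key` needs the approximation event, which has full conditional probability and may be
  -- intersected with.
  have hcap : ∀ S : Set Ω, (ProbabilityTheory.cond P (approxEvent X F T p K s CK ε)).real S
      = (ProbabilityTheory.cond P (approxEvent X F T p K s CK ε)).real
        (approxEvent X F T p K s CK ε ∩ S) := fun S => by
    rw [measureReal_def, measureReal_def,
      ProbabilityTheory.cond_inter_self hrun.measurableSet_approxEvent]
  -- For `T = 2, 3` each gap is at most `G √(2 D)`, which is already below `B`, so nothing random is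
  -- needed.
  obtain hT4 | hT4 := lt_or_ge T 4
  · have h1 : (1 : ℝ) ≤ (ProbabilityTheory.cond P (approxEvent X F T p K s CK ε)).real
        {ω | epsBullet X F T (fun t => x t ω) p (normalized T (stepSize G D Om))
          ≤ B + CK * ε} := by
      rw [← probReal_univ (μ := ProbabilityTheory.cond P (approxEvent X F T p K s CK ε)), hcap]
      refine measureReal_mono fun ω hω => key ω hω.1 ?_
      rw [Finset.sum_mul]
      refine Finset.sum_le_sum fun t ht => mul_le_mul_of_nonneg_left ?_ (hα t ht).le
      have hq := hp t ht (ihat t ω)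
      have h2 : u ω t ≤ G * √(2 * D) := by
        simp only [hu, expVal_sub_expVal]
        calc _ ≤ ∑ r, p t (ihat t ω) r * (G * √(2 * D)) :=
              Finset.sum_le_sum fun r _ => mul_le_mul_of_nonneg_left
                ((le_abs_self _).trans (abs_sub_le_of_bregmanDiam hX hψ hs hD (hF_lip _ r)
                  (hrun.iterate_mem ht ω) hy)) (hq.1 r)
          _ = G * √(2 * D) := by rw [← Finset.sum_mul, hq.2, one_mul]
      refine h2.trans ?_
      have h3 := sqrt_le_three_mul_log hT hT4
      have h4 : 1 ≤ √Om := Real.one_le_sqrt.2 hOm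
      have hT0 : 0 < (T : ℝ) := by exact_mod_cast (by omega : 0 < T)
      rw [hB, le_div_iff₀ (by positivity)]
      calc G * √(2 * D) * √T ≤ G * √(2 * D) * (3 * Real.log T) := by gcongr
        _ = 1 * (G * √(2 * D) * (3 * Real.log T)) := by ring
        _ ≤ √Om * (G * √(2 * D) * (3 * Real.log T)) := by gcongr
        _ = _ := by ring
    linarith
  refine (cond_deviation_le hX hψ hs hD hDpos hG hF_lip hp hOm hrun hE hy).trans ?_
  rw [hcap]
  refine measureReal_mono fun ω hω => key ω hω.1 ?_
  have h1 := hω.2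
  simp only [Set.mem_ofPred_eq] at h1
  have h2 := hrun.regret_le hX hψ hs hD hα hy (by omega) ω
  simp only [stepSize_sq hG' hDpos.le hOm0, ← Finset.mul_sum, ← Finset.sum_div] at h2
  refine le_trans ?_ (mul_le_sum_stepSize_mul hG' hDpos hOm0 hT4)
  simp only [mul_sub, Finset.sum_sub_distrib] at h1 h2 ⊢
  have hH : 0 ≤ ∑ t ∈ Finset.Icc 1 T, (t : ℝ)⁻¹ := Finset.sum_nonneg fun t _ => by positivity
  have h3 : D / Om * ∑ t ∈ Finset.Icc 1 T, (t : ℝ)⁻¹ ≤ D * ∑ t ∈ Finset.Icc 1 T, (t : ℝ)⁻¹ := by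
    gcongr
    exact div_le_self hD0 hOm
  simp only [hu, mul_sub, Finset.sum_sub_distrib]
  linarith

end run

/-! ### The theorem -/

theorem mainTheorem3
    {E : Type*} [NormedAddCommGroup E] [NormedSpace ℝ E] [FiniteDimensional ℝ E]
    [MeasurableSpace E] [BorelSpace E]
    {m n : ℕ}
    -- the decision set and the mirror descent setup
    (X : Set E) (hX_closed : IsClosed X) (hX_convex : Convex ℝ X)
    (ψ : E → ℝ) (hψ_diff : DifferentiableOn ℝ ψ X) (hψ_strong : StrongConvexOn X 1 ψ)
    (hD : BddAbove (bregmanValues X ψ))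
    -- convex, `G`-Lipschitz constraint functions
    (F : Fin m → Fin n → E → ℝ) (G : NNReal) (hG : 0 < G)
    (hF_convex : ∀ i r, ConvexOn ℝ X (F i r))
    (hF_lip : ∀ i r, LipschitzOnWith G (F i r) X)
    -- ambiguity sets and the given sequence of distributions
    (Pa : Fin m → Set (Fin n → ℝ)) (hPa_convex : ∀ i, Convex ℝ (Pa i))
    (hPa_compact : ∀ i, IsCompact (Pa i)) (hPa_simplex : ∀ i, Pa i ⊆ stdSimplex ℝ (Fin n))
    (T : ℕ) (hT : 2 ≤ T)
    (p : ℕ → Fin m → Fin n → ℝ) (hp : ∀ t ∈ Finset.Icc 1 T, ∀ i, p t i ∈ Pa i)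
    -- parameters
    (ε : ℝ) (hε : 0 < ε) (CK : ℝ) (hCK_nonneg : 0 ≤ CK) (hCK_lt : CK < 1 / 2)
    (Om : ℝ) (hOm : 1 ≤ Om)
    (K : ℕ → ℕ) (hK : ∀ t ∈ Finset.Icc 1 T, 0 < K t)
    -- a run of the algorithm
    {Ω : Type*} {mΩ : MeasurableSpace Ω} (P : Measure Ω) [IsProbabilityMeasure P]
    (ℱ : Filtration ℕ mΩ)
    (x : ℕ → Ω → E) (s : (t : ℕ) → Ω → Fin m → Fin (K t) → Fin n)
    (ihat : ℕ → Ω → Fin m) (I : ℕ → Ω → Fin n)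
    (hrun : IsEpsSMD P ℱ X ψ F G T p (stepSize G (bregmanDiam X ψ) Om) K x s ihat I) :
    -- conditionally on the approximation event
    (P (approxEvent X F T p K s CK ε) ≠ 0 →
      1 - 2 * Real.exp (-Om) ≤ (ProbabilityTheory.cond P (approxEvent X F T p K s CK ε)).real
        {ω | epsBullet X F T (fun t => x t ω) p
            (normalized T (stepSize G (bregmanDiam X ψ) Om))
          ≤ 3 * Real.sqrt Om * G * Real.log T * Real.sqrt (2 * bregmanDiam X ψ) / Real.sqrt T
            + CK * ε}) ∧
    -- unconditionally, if the approximation event has probability at least `1 - ν₁`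
    (∀ ν₁ : ℝ, 0 < ν₁ → ν₁ < 1 → 1 - ν₁ ≤ P.real (approxEvent X F T p K s CK ε) →
      1 - 2 * Real.exp (-Om) - ν₁ ≤ P.real
        {ω | epsBullet X F T (fun t => x t ω) p
            (normalized T (stepSize G (bregmanDiam X ψ) Om))
          ≤ 3 * Real.sqrt Om * G * Real.log T * Real.sqrt (2 * bregmanDiam X ψ) / Real.sqrt T
            + CK * ε}) := by
  have hCKε : 0 ≤ CK * ε := mul_nonneg hCK_nonneg hε.le
  have hcond : P (approxEvent X F T p K s CK ε) ≠ 0 → _ := cond_epsBullet_le hX_closed hX_convex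
    hψ_diff hψ_strong hD hG hF_lip hT (fun t ht i => hPa_simplex i (hp t ht i)) hCKε hOm hrun
  have hexp := Real.exp_pos (-Om)
  refine ⟨fun hE => by linarith [hcond hE], fun ν₁ hν0 hν1 hPE => ?_⟩
  have hpos : 0 < P.real (approxEvent X F T p K s CK ε) := by linarith
  have hE : P (approxEvent X F T p K s CK ε) ≠ 0 := fun h => by
    simp [measureReal_def, h] at hpos
  have h1 := hcond hE
  rw [measureReal_def, ProbabilityTheory.cond_apply hrun.measurableSet_approxEvent,
    ENNReal.toReal_mul, ENNReal.toReal_inv, ← measureReal_def, ← measureReal_def,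
    ← div_eq_inv_mul, le_div_iff₀ hpos] at h1
  refine le_trans ?_ (h1.trans (measureReal_mono Set.inter_subset_right))
  have h2 : Real.exp (-Om) ≤ 1 := Real.exp_le_one_iff.2 (by linarith)
  -- `(1 - ν₁) (1 - e^{-Ω}) ≥ 1 - e^{-Ω} - ν₁`.
  nlinarith [mul_le_mul_of_nonneg_left hPE (sub_nonneg.2 h2)]
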